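/- Let $G$ be a finite non-solvable group. For $x \in G$ put $\mathrm{nil}_G(x) = \{y \in G : \langle x, y\rangle \text{ is nilpotent}\}$. Suppose that $x \in G$ is an element such that the subgroup of $G$ generated by $\mathrm{nil}_G(x)$ is a maximal subgroup of $G$. Then: (1) $\langle x\rangle$ is properly contained in $\mathrm{nil}_G(x)$; (2) there is a nilpotent subgroup $H$ of $G$ that properly contains $\langle x\rangle$. -/

import Mathlib

/-- The nilpotentizer of `x` in `G`: the set of all `y` such that the subgroup generated by
`x` and `y` is nilpotent. -/
def nilpotentizer {G : Type*} [Group G] (x : G) : Set G :=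
  {y : G | Group.IsNilpotent (Subgroup.closure ({x, y} : Set G))}

open Subgroup

/-! If `nilpotentizer x` were just `zpowers x`, that cyclic subgroup M would be maximal, forcing G
to be solvable. To see this, factor out solvable normal subgroups by induction until none is
nontrivial. Maximality then makes M self-normalizing and the centralizer of each of its nontrivial
elements, so M meets its other conjugates trivially. Transfer gives f : G → M injective on M, and x
acts on ker f without nontrivial fixed points, so it normalizes a nontrivial p-subgroup Q of ker f.
Then Q ≤ N(Q) = M, against injectivity of f on M. -/

/-- A fixed-point-free automorphism of a finite group stabilizes some Sylow `p`-subgroup. -/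
theorem Sylow.exists_smul_eq_of_fixedPointFree {N : Type*} [Group N] [Finite N] (p : ℕ)
    [Fact p.Prime] (φ : MulAut N) (hφ : MonoidHom.FixedPointFree φ) :
    ∃ P : Sylow p N, φ • P = P := by
  let P : Sylow p N := default
  obtain ⟨g, hg⟩ := MulAction.exists_smul_eq N P (φ • P)
  -- By finiteness `k ↦ k / φ k` is onto. Writing g = φ(k) k⁻¹ gives φ(k⁻¹P) = φ(k)⁻¹gP = k⁻¹P.
  obtain ⟨k, hk⟩ := hφ.commutatorMap_surjective g⁻¹
  have key : ∀ h : N, φ • h • P = φ h • φ • P := by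
    intro h
    rw [Sylow.smul_def, Sylow.smul_def, ← mul_smul, ← mul_smul]
    congr 1
    ext y
    simp
  refine ⟨k⁻¹ • P, ?_⟩
  rw [key, ← hg, ← mul_smul]
  congr 1
  rw [MonoidHom.commutatorMap_apply] at hk
  rw [← inv_inj, mul_inv_rev, ← hk, map_inv, inv_inv, inv_inv, div_mul_cancel]

/-- If conjugation by `x` fixes no nontrivial element of a nontrivial normal subgroup `N`, then `x`
normalizes a nontrivial `p`-subgroup of `N`. -/
theorem Subgroup.exists_isPGroup_mem_normalizer {G : Type*} [Group G] [Finite G] (N : Subgroup G)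
    [N.Normal] (hN : N ≠ ⊥) (x : G) (hx : ∀ n ∈ N, x * n = n * x → n = 1) :
    ∃ (p : ℕ) (_ : p.Prime) (Q : Subgroup G), Q ≤ N ∧ Q ≠ ⊥ ∧ IsPGroup p Q ∧
      x ∈ normalizer (Q : Set G) := by
  have hcard : Nat.card N ≠ 1 := fun h => hN (Subgroup.card_eq_one.mp h)
  obtain ⟨p, hp, hdvd⟩ := Nat.exists_prime_and_dvd hcard
  have := Fact.mk hp
  have hφ : MonoidHom.FixedPointFree (MulAut.conjNormal x : MulAut N) := by
    intro n hn
    ext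
    refine hx n n.2 ?_
    have := congrArg Subtype.val hn
    rw [MulAut.conjNormal_apply] at this
    exact mul_inv_eq_iff_eq_mul.mp this
  obtain ⟨P, hP⟩ := Sylow.exists_smul_eq_of_fixedPointFree p _ hφ
  refine ⟨p, hp, (P : Subgroup N).map N.subtype, map_subtype_le _, ?_, P.2.map _, ?_⟩
  · rw [Ne, map_eq_bot_iff_of_injective _ N.subtype_injective]
    exact P.ne_bot_of_dvd_card hdvd
  · have hmem : ∀ n : N, n ∈ P ↔ MulAut.conjNormal x n ∈ P := by
      intro n
      conv_rhs => rw [← hP]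
      exact (smul_mem_pointwise_smul_iff (a := (MulAut.conjNormal x : MulAut N))
        (S := (P : Subgroup N)) (x := n)).symm
    rw [mem_normalizer_iff]
    intro g
    simp only [mem_map, subtype_apply]
    constructor
    · rintro ⟨n, hn, rfl⟩
      exact ⟨_, (hmem n).mp hn, MulAut.conjNormal_apply x n⟩
    · rintro ⟨n, hn, h⟩
      refine ⟨MulAut.conjNormal x⁻¹ n, (hmem _).mpr ?_, ?_⟩
      · rwa [← MulAut.mul_apply, ← map_mul, mul_inv_cancel, map_one]
      · rw [MulAut.conjNormal_apply, h]
        group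

/-- The index of a subgroup that meets its other conjugates trivially is prime to its order. -/
theorem Subgroup.eq_one_of_pow_index_eq_one {G : Type*} [Group G] [Finite G] (M : Subgroup G)
    (hM : ∀ g, g ∉ M → ∀ m ∈ M, g⁻¹ * m * g ∈ M → m = 1) (m : G) (hm : m ∈ M)
    (h : m ^ M.index = 1) : m = 1 := by
  by_contra hne
  have ho : orderOf m ≠ 1 := fun h => hne (orderOf_eq_one_iff.mp h)
  obtain ⟨p, hp, k, hk⟩ := Nat.exists_prime_and_dvd ho
  have := Fact.mk hp
  have hk0 : k ≠ 0 := by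
    rintro rfl
    exact (orderOf_pos m).ne' (by simpa using hk)
  have hord : orderOf (m ^ k) = p := by
    rw [orderOf_pow_of_dvd hk0 ⟨p, by rw [hk, mul_comm]⟩, hk, Nat.mul_div_cancel _ hk0.bot_lt]
  have hP : IsPGroup p (zpowers (m ^ k)) :=
    IsPGroup.of_card (n := 1) (by rw [Nat.card_zpowers, hord, pow_one])
  have hmk : m ^ k ∈ M := M.pow_mem hm k
  have hd : p ∣ Nat.card (G ⧸ M) :=
    (Dvd.intro k hk.symm).trans (orderOf_dvd_of_pow_eq_one h)
  have hfix : ((1 : G) : G ⧸ M) ∈ MulAction.fixedPoints (zpowers (m ^ k)) (G ⧸ M) := by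
    rintro ⟨y, hy⟩
    have hyM : y ∈ M := (zpowers_le.mpr hmk) hy
    change ((y * 1 : G) : G ⧸ M) = ((1 : G) : G ⧸ M)
    rw [eq_comm, QuotientGroup.eq]
    simpa using hyM
  -- The fixed points number 0 mod p and include the coset M, so another coset gM is fixed, putting
  -- g⁻¹mᵏg in M.
  obtain ⟨b, hb, hne'⟩ := hP.exists_fixed_point_of_prime_dvd_card_of_fixed_point _ hd hfix
  induction b using QuotientGroup.induction_on with | H g => ?_
  have hg : g ∉ M := by
    intro hg
    apply hne'
    rw [QuotientGroup.eq]
    simpa using hg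
  have h1 : ((m ^ k * g : G) : G ⧸ M) = (g : G ⧸ M) := hb ⟨m ^ k, mem_zpowers _⟩
  rw [eq_comm, QuotientGroup.eq, ← mul_assoc] at h1
  have h2 := hM g hg _ hmk h1
  rw [h2, orderOf_one] at hord
  exact hp.one_lt.ne hord

open scoped IsMulCommutative in
/-- If a commutative subgroup meets its other conjugates trivially, then some homomorphism from the
whole group to it is injective on it. -/
theorem Subgroup.exists_hom_of_isMulCommutative {G : Type*} [Group G] [Finite G] (M : Subgroup G)
    [IsMulCommutative M] (hM : ∀ g, g ∉ M → ∀ m ∈ M, g⁻¹ * m * g ∈ M → m = 1) :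
    ∃ f : G →* M, ∀ m ∈ M, f m = 1 → m = 1 := by
  refine ⟨MonoidHom.transfer (MonoidHom.id M), fun m hm h => ?_⟩
  -- On M the transfer is m ↦ m ^ `M.index`, provided M-conjugates of powers of m that land in M are
  -- unchanged.
  rw [MonoidHom.transfer_eq_pow] at h
  · exact M.eq_one_of_pow_index_eq_one hM m hm (congrArg Subtype.val h)
  · intro k g hg
    have hmk := M.pow_mem hm k
    by_cases hgM : g ∈ M
    · have hc : m ^ k * g = g * m ^ k := setLike_mul_comm hmk hgM
      rw [mul_assoc, hc, inv_mul_cancel_left]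
    · rw [hM g hgM _ hmk hg]
      simp

/-- A finite group without nontrivial normal solvable subgroups is solvable if no subgroup lies
strictly between some cyclic subgroup and the whole group. -/
theorem Group.isSolvable_of_zpowers_of_no_normal {G : Type*} [Group G] [Finite G] (x : G)
    (hx : ∀ K : Subgroup G, zpowers x ≤ K → K = zpowers x ∨ K = ⊤)
    (hA : ∀ A : Subgroup G, A.Normal → Group.IsSolvable A → A = ⊥) : Group.IsSolvable G := by
  by_contra hG
  have hcomm : ¬ ∀ a b : G, a * b = b * a := fun h => hG (Group.isSolvable_of_comm h)
  have hsolv : ∀ H : Subgroup G, Group.IsSolvable H → H ≠ ⊤ := by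
    rintro _ h rfl
    exact hG (Group.isSolvable_of_surjective (f := (topEquiv : (⊤ : Subgroup G) ≃* G).toMonoidHom)
      (topEquiv : (⊤ : Subgroup G) ≃* G).surjective)
  have hMtop : zpowers x ≠ ⊤ := hsolv _ inferInstance
  have hMbot : zpowers x ≠ ⊥ := by
    intro h
    obtain ⟨y, hy⟩ : ∃ y : G, y ≠ 1 := by
      by_contra! hall
      exact hcomm fun a b => by rw [hall a, hall b]
    rcases hx (zpowers y) (h ▸ bot_le) with h1 | h1
    · rw [h, zpowers_eq_bot] at h1
      exact hy h1
    · exact hsolv (zpowers y) inferInstance h1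
  have hnormal : ∀ Q : Subgroup G, Group.IsSolvable Q → Q ≠ ⊥ → zpowers x ≤ normalizer (Q : Set G) →
      normalizer (Q : Set G) = zpowers x := by
    intro Q hQ hne hle
    refine (hx _ hle).resolve_right fun h => hne (hA Q (normalizer_eq_top_iff.mp h) hQ)
  have hself : normalizer (zpowers x : Set G) = zpowers x :=
    hnormal _ inferInstance hMbot le_normalizer
  have hcent : ∀ m : G, m ≠ 1 → m ∈ zpowers x → centralizer {m} = zpowers x := by
    intro m hm hmx
    have hle : zpowers x ≤ centralizer {m} := by
      rw [zpowers_le, mem_centralizer_singleton_iff]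
      exact setLike_mul_comm (mem_zpowers x) hmx
    refine (hx _ hle).resolve_right fun h => hm ?_
    have hmc : m ∈ center G := by
      rw [mem_center_iff]
      intro g
      have hg : g ∈ centralizer {m} := h ▸ mem_top g
      exact (mem_centralizer_singleton_iff.mp hg)
    have := hA (center G) inferInstance <|
      Group.isSolvable_of_comm fun a b => Subtype.ext (mem_center_iff.mp b.2 a)
    rwa [this, mem_bot] at hmc
  have hTI : ∀ g, g ∉ zpowers x → ∀ m ∈ zpowers x, g⁻¹ * m * g ∈ zpowers x → m = 1 := by
    intro g hg m hm hgm
    by_contra hne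
    have hne' : g⁻¹ * m * g ≠ 1 := by
      intro h
      apply hne
      simpa [mul_assoc] using congrArg (fun t => g * t * g⁻¹) h
    apply hg
    -- The centralizer of g⁻¹mg is M and contains g⁻¹xg, so g normalizes M.
    have hc := hcent _ hne' hgm
    have hconj : g⁻¹ * x * g ∈ zpowers x := by
      rw [← hc, mem_centralizer_singleton_iff]
      have : x * m = m * x := setLike_mul_comm (mem_zpowers x) hm
      calc g⁻¹ * x * g * (g⁻¹ * m * g) = g⁻¹ * (x * m) * g := by group
        _ = g⁻¹ * m * g * (g⁻¹ * x * g) := by rw [this]; group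
    have hinv : g⁻¹ ∈ normalizer (zpowers x : Set G) := by
      refine mem_normalizer_fintype ?_
      rintro _ ⟨i, rfl⟩
      have := zpow_mem hconj i
      have hc := conj_zpow (i := i) (a := g⁻¹) (b := x)
      rw [inv_inv] at hc
      rw [hc] at this
      simpa using this
    rw [hself] at hinv
    exact inv_mem_iff.mp hinv
  obtain ⟨f, hf⟩ := (zpowers x).exists_hom_of_isMulCommutative hTI
  have hNbot : f.ker ≠ ⊥ := by
    intro h
    exact hG (Group.isSolvable_of_isSolvable_injective (f.ker_eq_bot_iff.mp h))
  have hx1 : x ≠ 1 := fun h => hMbot (zpowers_eq_bot.mpr h)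
  obtain ⟨p, hp, Q, hQN, hQ, hpQ, hxQ⟩ := f.ker.exists_isPGroup_mem_normalizer hNbot x <| by
    intro n hn hxn
    -- An element commuting with x lies in C(x) = ⟨x⟩, where f is injective.
    refine hf n ?_ hn
    rw [← hcent x hx1 (mem_zpowers x), mem_centralizer_singleton_iff]
    exact hxn.symm
  have := Fact.mk hp
  have := hpQ.isNilpotent
  have hnQ := hnormal Q inferInstance hQ (zpowers_le.mpr hxQ)
  refine hQ ((eq_bot_iff_forall Q).mpr fun q hq => hf q (hnQ ▸ le_normalizer hq) (hQN hq))

/-- A finite group is solvable if no subgroup lies strictly between some cyclic subgroup and the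
whole group. -/
theorem Group.isSolvable_of_zpowers_maximal {G : Type*} [Group G] [Finite G] (x : G)
    (hx : ∀ K : Subgroup G, zpowers x ≤ K → K = zpowers x ∨ K = ⊤) : Group.IsSolvable G := by
  induction hn : Nat.card G using Nat.strong_induction_on generalizing G with | _ n ih => ?_
  by_cases hA : ∀ A : Subgroup G, A.Normal → Group.IsSolvable A → A = ⊥
  · exact Group.isSolvable_of_zpowers_of_no_normal x hx hA
  push Not at hA
  obtain ⟨A, hnor, hsol, hne⟩ := hA
  have hlt : Nat.card (G ⧸ A) < n := by
    have h1 := A.card_mul_index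
    have h2 : 1 < Nat.card A := A.one_lt_card_iff_ne_bot.mpr hne
    have h3 : 0 < Nat.card (G ⧸ A) := Nat.card_pos
    rw [hn, index] at h1
    rw [← h1]
    exact lt_mul_left h3 h2
  have hq : Group.IsSolvable (G ⧸ A) := by
    -- Allowing ⟨x⟩ = ⊤ in the hypothesis lets it pass to the quotient even when ⟨x⟩A = G.
    refine ih _ hlt (QuotientGroup.mk' A x) (fun K hK => ?_) rfl
    rw [← MonoidHom.map_zpowers] at hK ⊢
    have hs := QuotientGroup.mk'_surjective A
    rcases hx _ (map_le_iff_le_comap.mp hK) with h | h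
    · left
      rw [← h, map_comap_eq_self_of_surjective hs]
    · right
      rw [← map_comap_eq_self_of_surjective hs K, h, map_top_of_surjective _ hs]
  exact Group.isSolvable_of_ker_le_range A.subtype (QuotientGroup.mk' A) (by simp)

open scoped IsMulCommutative in
/-- The nilpotentizer of `x` contains every power of `x`. -/
theorem zpowers_subset_nilpotentizer {G : Type*} [Group G] (x : G) :
    (zpowers x : Set G) ⊆ nilpotentizer x := by
  intro y hy
  have hle : closure ({x, y} : Set G) ≤ zpowers x := by
    rw [closure_le]
    rintro z (rfl | rfl)
    · exact mem_zpowers _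
    · exact hy
  refine Subgroup.isNilpotent_of_ker_le_center (inclusion hle) ?_
  rw [(inclusion hle).ker_eq_bot_iff.mpr (inclusion_injective hle)]
  exact bot_le

theorem mainTheorem8 {G : Type*} [Group G] [Finite G] (hG : ¬ Group.IsSolvable G) (x : G)
    (hx : IsCoatom (Subgroup.closure (nilpotentizer x))) :
    (Subgroup.zpowers x : Set G) ⊂ nilpotentizer x ∧
      ∃ H : Subgroup G, Group.IsNilpotent H ∧ Subgroup.zpowers x < H := by
  have hss : (Subgroup.zpowers x : Set G) ⊂ nilpotentizer x := by
    refine (zpowers_subset_nilpotentizer x).ssubset_of_ne fun h => hG ?_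
    rw [← h, closure_eq] at hx
    refine Group.isSolvable_of_zpowers_maximal x fun K hK => ?_
    rcases hK.eq_or_lt with h | h
    · exact Or.inl h.symm
    · exact Or.inr (hx.2 K h)
  refine ⟨hss, ?_⟩
  obtain ⟨y, hy, hyx⟩ := Set.exists_of_ssubset hss
  refine ⟨closure {x, y}, hy, lt_of_le_of_ne (zpowers_le.mpr (subset_closure (by simp))) ?_⟩
  intro h
  apply hyx
  rw [h]
  exact subset_closure (by simp)
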